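/- **Theorem.** Thompson's group $F$ has infinite weak cop number. That is, $F$ is finitely generated, and for every finite generating set $S$ of $F$ the Cayley graph $\mathrm{Cay}(F,S)$ satisfies $\mathrm{wCop}(\mathrm{Cay}(F,S))=\infty$. Here $F$ is the group, under composition, of orientation-preserving piecewise linear homeomorphisms of $[0,1]$ whose break points are finitely many dyadic rationals and whose slopes are all integral powers of $2$. The graph $\mathrm{Cay}(F,S)$ is the simple graph with vertex set $F$ in which two distinct elements $g,h$ are adjacent if and only if $h=gs$ or $g=hs$ for some $s\in S$. The weak cop number of a connected graph $\Gamma$ is defined by the following game. Fix $n\in\mathbb N$, positive integers $\sigma,\rho$ (the speed and the reach of the cops), $\psi$ (the speed of the robber), $R$ (a radius), and a vertex $v$. First the $n$ cops choose their initial vertices; then the robber, knowing these, chooses his initial vertex. The two sides move in alternating turns with perfect information, starting with the cops. On the cops' turn each cop moves to a vertex at distance at most $\sigma$ from its current position; the robber is *captured* if after this some cop is within distance $\rho$ of him. On his turn the robber, if he has not been captured, moves to a vertex at distance at most $\psi$ from his current position for which there is a path in $\Gamma$ from his current position containing no vertex within distance $\rho$ of any cop. The cops win if the robber is captured or if, from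 some turn on, the robber is never within distance $R$ of $v$. The graph $\Gamma$ is $\mathrm{CopWin}(n,\sigma,\rho,\psi,R)$ if for every vertex $v$ the $n$ cops have a winning strategy; $\Gamma$ is *$n$-weak cop win* if there are positive integers $\sigma,\rho$ such that $\Gamma$ is $\mathrm{CopWin}(n,\sigma,\rho,\psi,R)$ for all positive integers $\psi,R$. The weak cop number $\mathrm{wCop}(\Gamma)$ is the smallest $n$ such that $\Gamma$ is $n$-weak cop win, and $\mathrm{wCop}(\Gamma)=\infty$ if there is no such $n$. -/

import Mathlib

/-! ### Weak Cops and Robbers on a graph -/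

namespace WeakCops

variable {V : Type*}

/-- A strategy for `n` cops of speed `σ`. The game has perfect information, and the moves of the
cops are determined by the strategy and the moves of the robber; so a strategy assigns to each list
`[r₀, …, r_{t-1}]` of successive positions of the robber the positions of the `n` cops after their
`t`-th turn. The empty list gives the initial positions of the cops, chosen before the robber
chooses `r₀`. In each turn each cop moves to a vertex at distance at most `σ`. -/
structure CopStrategy (Γ : SimpleGraph V) (n σ : ℕ) where
  pos : List V → Fin n → V
  speed : ∀ (l : List V) (x : V) (i : Fin n), Γ.edist (pos l i) (pos (l ++ [x]) i) ≤ (σ : ℕ∞)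

/-- Positions of the cops after their `t`-th turn (`t = 0`: initial positions), when the robber's
positions are `r 0, r 1, …`. The cops' turn number `t + 1` takes place when the robber is
at `r t`. -/
def CopStrategy.at {Γ : SimpleGraph V} {n σ : ℕ} (s : CopStrategy Γ n σ) (r : ℕ → V) (t : ℕ) :
    Fin n → V :=
  s.pos ((List.range t).map r)

/-- The robber, standing at `x`, is within reach `ρ` of one of the cops at `c`. -/
def InReach (Γ : SimpleGraph V) {n : ℕ} (ρ : ℕ) (c : Fin n → V) (x : V) : Prop :=
  ∃ i, Γ.edist (c i) x ≤ (ρ : ℕ∞)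

/-- A legal move of the robber from `x` to `y` while the cops are at `c`: the vertex `y` is at
distance at most `ψ` from `x`, and there is a path from `x` to `y` which contains no vertex within
distance `ρ` of a cop. -/
def RobberMove (Γ : SimpleGraph V) {n : ℕ} (ρ ψ : ℕ) (c : Fin n → V) (x y : V) : Prop :=
  Γ.edist x y ≤ (ψ : ℕ∞) ∧ ∃ p : Γ.Walk x y, ∀ w ∈ p.support, ¬ InReach Γ ρ c w

/-- The robber is captured during the cops' turn number `t + 1`. -/
def CapturedAt {Γ : SimpleGraph V} {n σ : ℕ} (ρ : ℕ) (s : CopStrategy Γ n σ) (r : ℕ → V)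
    (t : ℕ) : Prop :=
  InReach Γ ρ (s.at r (t + 1)) (r t)

/-- `r` is a play of the robber against `s`: as long as he has not been captured, all his moves
are legal (what `r` does after a capture is irrelevant). -/
def IsRobberPlay {Γ : SimpleGraph V} {n σ : ℕ} (ρ ψ : ℕ) (s : CopStrategy Γ n σ)
    (r : ℕ → V) : Prop :=
  ∀ t, (∀ u ≤ t, ¬ CapturedAt ρ s r u) → RobberMove Γ ρ ψ (s.at r (t + 1)) (r t) (r (t + 1))

/-- `n` cops of speed `σ` and reach `ρ` can, against a robber of speed `ψ`, eventually protect the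
ball of radius `R` centered at `v`: they have a strategy such that in each play the robber is
captured, or from some turn on he is never within distance `R` of `v`. -/
def CanProtect (Γ : SimpleGraph V) (n σ ρ ψ R : ℕ) (v : V) : Prop :=
  ∃ s : CopStrategy Γ n σ, ∀ r : ℕ → V, IsRobberPlay ρ ψ s r →
    (∃ t, CapturedAt ρ s r t) ∨ ∃ T, ∀ t ≥ T, ¬ Γ.edist v (r t) ≤ (R : ℕ∞)

/-- The graph is CopWin`(n, σ, ρ, ψ, R)`. -/
def CopWin (Γ : SimpleGraph V) (n σ ρ ψ R : ℕ) : Prop :=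
  ∀ v : V, CanProtect Γ n σ ρ ψ R v

/-- The graph is `n`-weak cop win. -/
def IsWeakCopWin (Γ : SimpleGraph V) (n : ℕ) : Prop :=
  ∃ σ > 0, ∃ ρ > 0, ∀ ψ > 0, ∀ R > 0, CopWin Γ n σ ρ ψ R

/-- The weak cop number: the smallest `n` such that the graph is `n`-weak cop win, and `⊤` if there
is no such `n`. -/
noncomputable def weakCopNumber (Γ : SimpleGraph V) : ℕ∞ :=
  sInf ((fun n : ℕ => (n : ℕ∞)) '' {n : ℕ | IsWeakCopWin Γ n})

end WeakCops

/-! ### Thompson's group `F` -/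

namespace Thompson

/-- Dyadic rationals. -/
def IsDyadic (x : ℝ) : Prop := ∃ (a : ℤ) (k : ℕ), x = a / 2 ^ k

/-- `g` is piecewise linear, with finitely many break points, which are dyadic rationals, and all
slopes are integral powers of `2`: there is a finite set `D` of dyadic rationals such that on each
interval `[a, b]` with no point of `D` in its interior, `g` is affine of slope `2 ^ m` for
some integer `m`. -/
def IsDyadicPL (g : unitInterval → unitInterval) : Prop :=
  ∃ D : Finset unitInterval, (∀ d ∈ D, IsDyadic (d : ℝ)) ∧
    ∀ a b : unitInterval, (∀ d ∈ D, ¬ (a < d ∧ d < b)) →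
      ∃ m : ℤ, ∀ x ∈ Set.Icc a b, (g x : ℝ) - (g a : ℝ) = (2 : ℝ) ^ m * ((x : ℝ) - (a : ℝ))

theorem IsDyadic.add {x y : ℝ} (hx : IsDyadic x) (hy : IsDyadic y) : IsDyadic (x + y) := by
  obtain ⟨a, k, rfl⟩ := hx
  obtain ⟨b, l, rfl⟩ := hy
  refine ⟨a * 2 ^ l + b * 2 ^ k, k + l, ?_⟩
  push_cast
  field_simp
  ring

theorem IsDyadic.neg {x : ℝ} (hx : IsDyadic x) : IsDyadic (-x) := by
  obtain ⟨a, k, rfl⟩ := hx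
  refine ⟨-a, k, ?_⟩
  push_cast
  ring

theorem IsDyadic.sub {x y : ℝ} (hx : IsDyadic x) (hy : IsDyadic y) : IsDyadic (x - y) := by
  rw [sub_eq_add_neg]
  exact hx.add hy.neg

theorem IsDyadic.zpow_mul {x : ℝ} (m : ℤ) (hx : IsDyadic x) : IsDyadic ((2 : ℝ) ^ m * x) := by
  obtain ⟨a, k, rfl⟩ := hx
  obtain ⟨n, rfl | rfl⟩ := m.eq_nat_or_neg
  · refine ⟨2 ^ n * a, k, ?_⟩
    push_cast
    rw [zpow_natCast]
    ring
  · refine ⟨a, n + k, ?_⟩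
    rw [zpow_neg, zpow_natCast, pow_add]
    field_simp

theorem map_zero_of_strictMono (g : unitInterval ≃ₜ unitInterval) (hg : StrictMono g) :
    g 0 = 0 := by
  refine le_antisymm ?_ unitInterval.nonneg'
  have h : g 0 ≤ g (g.symm 0) := hg.monotone unitInterval.nonneg'
  rwa [g.apply_symm_apply] at h

/-- Orientation-preserving dyadic piecewise linear homeomorphisms preserve dyadic rationals, and so
do their inverses. -/
theorem isDyadic_apply_iff (g : unitInterval ≃ₜ unitInterval) (hg : StrictMono g)
    (hpl : IsDyadicPL g) (x : unitInterval) : IsDyadic (g x : ℝ) ↔ IsDyadic (x : ℝ) := by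
  obtain ⟨D, hD, hlin⟩ := hpl
  have hz : IsDyadic 0 := ⟨0, 0, by simp⟩
  induction hn : (D.filter (· < x)).card using Nat.strong_induction_on generalizing x with
  | _ n ih =>
    subst hn
    by_cases hne : (D.filter (· < x)).Nonempty
    · obtain ⟨a, ha, hmax⟩ : ∃ a ∈ D.filter (· < x), ∀ d ∈ D.filter (· < x), d ≤ a :=
        ⟨_, Finset.max'_mem _ hne, fun d hd => Finset.le_max' _ d hd⟩
      obtain ⟨haD, hax⟩ := Finset.mem_filter.1 ha
      have hlt : (D.filter (· < a)).card < (D.filter (· < x)).card := by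
        refine Finset.card_lt_card ⟨fun d hd => ?_, fun hsub => ?_⟩
        · obtain ⟨h1, h2⟩ := Finset.mem_filter.1 hd
          exact Finset.mem_filter.2 ⟨h1, h2.trans hax⟩
        · exact lt_irrefl a (Finset.mem_filter.1 (hsub ha)).2
      have hga : IsDyadic (g a : ℝ) := (ih _ hlt a rfl).2 (hD a haD)
      obtain ⟨m, hm⟩ := hlin a x fun d hd hdx =>
        absurd (hmax d (Finset.mem_filter.2 ⟨hd, hdx.2⟩)) (not_le.2 hdx.1)
      have hx := hm x ⟨hax.le, le_rfl⟩
      constructor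
      · intro h
        have h1 := ((h.sub hga).zpow_mul (-m)).add (hD a haD)
        rw [hx, ← mul_assoc, ← zpow_add₀ two_ne_zero] at h1
        simpa using h1
      · intro h
        have h1 := ((h.sub (hD a haD)).zpow_mul m).add hga
        rw [← hx] at h1
        simpa using h1
    · obtain ⟨m, hm⟩ := hlin 0 x fun d hd hdx =>
        hne ⟨d, Finset.mem_filter.2 ⟨hd, hdx.2⟩⟩
      have hx := hm x ⟨unitInterval.nonneg', le_rfl⟩
      rw [map_zero_of_strictMono g hg] at hx
      simp only [Set.Icc.coe_zero, sub_zero] at hx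
      constructor
      · intro h
        have h1 := h.zpow_mul (-m)
        rw [hx, ← mul_assoc, ← zpow_add₀ two_ne_zero] at h1
        simpa using h1
      · intro h
        rw [hx]
        exact h.zpow_mul m

/-- Thompson's group `F`: the group, under composition, of the orientation-preserving piecewise
linear homeomorphisms of the unit interval whose finitely many break points are dyadic rationals and
whose slopes are powers of `2`. -/
def F : Subgroup (unitInterval ≃ₜ unitInterval) where
  carrier := {g | StrictMono g ∧ IsDyadicPL g}
  one_mem' := ⟨fun _ _ h => h, ∅, by simp, fun a b _ => ⟨0, fun x _ => by simp⟩⟩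
  mul_mem' := by
    classical
    rintro f g ⟨hf, Df, hDf, hlf⟩ ⟨hg, hgpl⟩
    have hdy := isDyadic_apply_iff g hg hgpl
    obtain ⟨Dg, hDg, hlg⟩ := hgpl
    refine ⟨hf.comp hg, Dg ∪ Df.image g.symm, fun d hd => ?_, fun a b hab => ?_⟩
    · rcases Finset.mem_union.1 hd with h | h
      · exact hDg d h
      · obtain ⟨e, he, rfl⟩ := Finset.mem_image.1 h
        rw [← hdy, g.apply_symm_apply]
        exact hDf e he
    · obtain ⟨m, hm⟩ := hlg a b fun d hd => hab d (Finset.mem_union_left _ hd)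
      obtain ⟨k, hk⟩ := hlf (g a) (g b) fun d hd hdd => by
        refine hab (g.symm d) (Finset.mem_union_right _ (Finset.mem_image_of_mem _ hd)) ⟨?_, ?_⟩
        · rw [← hg.lt_iff_lt, g.apply_symm_apply]
          exact hdd.1
        · rw [← hg.lt_iff_lt, g.apply_symm_apply]
          exact hdd.2
      refine ⟨k + m, fun x hx => ?_⟩
      have h1 := hk (g x) ⟨hg.monotone hx.1, hg.monotone hx.2⟩
      rw [hm x hx, ← mul_assoc, ← zpow_add₀ two_ne_zero] at h1
      exact h1
  inv_mem' := by
    classical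
    rintro g ⟨hg, hgpl⟩
    have hdy := isDyadic_apply_iff g hg hgpl
    obtain ⟨D, hD, hl⟩ := hgpl
    have hmono : StrictMono g.symm := fun x y hxy => by
      rw [← hg.lt_iff_lt, g.apply_symm_apply, g.apply_symm_apply]
      exact hxy
    refine ⟨hmono, D.image g, fun d hd => ?_, fun a b hab => ?_⟩
    · obtain ⟨e, he, rfl⟩ := Finset.mem_image.1 hd
      exact (hdy e).2 (hD e he)
    · obtain ⟨m, hm⟩ := hl (g.symm a) (g.symm b) fun d hd hdd => by
        refine hab (g d) (Finset.mem_image_of_mem _ hd) ⟨?_, ?_⟩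
        · rw [← hmono.lt_iff_lt, g.symm_apply_apply]
          exact hdd.1
        · rw [← hmono.lt_iff_lt, g.symm_apply_apply]
          exact hdd.2
      refine ⟨-m, fun x hx => ?_⟩
      have h1 := hm (g.symm x) ⟨hmono.monotone hx.1, hmono.monotone hx.2⟩
      rw [g.apply_symm_apply, g.apply_symm_apply] at h1
      rw [h1, ← mul_assoc, ← zpow_add₀ two_ne_zero]
      simp only [neg_add_cancel, zpow_zero, one_mul]
      rfl

end Thompson

/-! The logarithms of the slopes at 0 and at 1 are homomorphisms from F to ℤ. The copies `a` and `b`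
of `x₀` acting on the two halves of the interval commute, and after one change of sign the two
homomorphisms are dual to them. So F retracts onto ℤ², and the robber plays in this plane.

The coordinates φ, ψ are Lipschitz on the Cayley graph, so a cop who is far away in one coordinate
is out of reach. The robber stops only where `n + 1` widely spaced columns cross `n + 1` widely
spaced rows: `n` cops can be near neither all columns nor all rows. He stands on a column that was
clear before the cops' turn and is still nearly as clear after it. He follows it to a row that is
clear now, and that row to a column that is clear now. The grid depends only on the group data and
on `n`, `σ`, `ρ`, so a bounded speed suffices and he never leaves a fixed ball
(`weakCopNumber_mulCayley_eq_top`).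

For finite generation, each element maps the leaves of some binary tree affinely onto standard
dyadic intervals (`exists_isTreeAffine`). Right multiplication by `x₀⁻¹` rotates the tree until its
left child is a leaf; left multiplication by `x₀` then stretches the image of the left half until
that half is fixed. What remains lives on the right half and has a smaller tree. The induction
closes because the subgroup generated by `x₀` and `rightHalf x₀` is stable under `rightHalf`, by
`x₀_mul_rightHalf`. -/

namespace WeakCops

/-! ### Coordinates along walks in a Cayley graph -/

section Cayley

variable {G : Type*} [Group G] {S : Set G}

/-- Edges are right multiplications by generators, so left translation carries one path for `a` to
every base point; hence `m` does not depend on `g`. -/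
theorem exists_walk_mulCayley_mul (hS : Subgroup.closure S = ⊤) (a : G) :
    ∃ m : ℕ, ∀ g : G, ∃ p : (SimpleGraph.mulCayley S).Walk g (g * a), p.length ≤ m := by
  have ha : a ∈ Subgroup.closure S := hS ▸ Subgroup.mem_top a
  induction ha using Subgroup.closure_induction with
  | mem s hs =>
    refine ⟨1, fun g => ?_⟩
    by_cases h : g = g * s
    · exact ⟨SimpleGraph.Walk.nil.copy rfl h, by simp⟩
    · exact ⟨((SimpleGraph.mulCayley_adj' S g (g * s)).2 ⟨h, s, hs, Or.inl rfl⟩).toWalk, by simp⟩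
  | one => exact ⟨0, fun g => ⟨SimpleGraph.Walk.nil.copy rfl (mul_one g).symm, by simp⟩⟩
  | mul x y _ _ hx hy =>
    obtain ⟨m, hm⟩ := hx
    obtain ⟨k, hk⟩ := hy
    refine ⟨m + k, fun g => ?_⟩
    obtain ⟨p, hp⟩ := hm g
    obtain ⟨q, hq⟩ := hk (g * x)
    refine ⟨(p.append q).copy rfl (mul_assoc g x y), ?_⟩
    simp only [SimpleGraph.Walk.length_copy, SimpleGraph.Walk.length_append]
    omega
  | inv x _ hx =>
    obtain ⟨m, hm⟩ := hx
    refine ⟨m, fun g => ?_⟩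
    obtain ⟨p, hp⟩ := hm (g * x⁻¹)
    exact ⟨p.reverse.copy (inv_mul_cancel_right g x) rfl, by simpa using hp⟩

theorem abs_sub_le_of_mem_support {φ : G → ℤ} (hφ : ∀ g h, φ (g * h) = φ g + φ h) {L : ℕ}
    (hL : ∀ s ∈ S, |φ s| ≤ L) {u v : G} (p : (SimpleGraph.mulCayley S).Walk u v) :
    ∀ w ∈ p.support, |φ w - φ u| ≤ L * p.length := by
  induction p with
  | nil => simp
  | @cons u v x h p ih =>
    intro w hw
    rw [SimpleGraph.Walk.support_cons, List.mem_cons] at hw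
    rw [SimpleGraph.Walk.length_cons]
    push_cast
    rcases hw with rfl | hw
    · simp only [sub_self, abs_zero]
      positivity
    · have h1 := ih w hw
      have h2 : |φ v - φ u| ≤ L := by
        obtain ⟨_, s, hs, rfl | rfl⟩ := (SimpleGraph.mulCayley_adj' S _ _).1 h
        · rw [hφ, add_sub_cancel_left]
          exact hL s hs
        · rw [hφ, abs_sub_comm, add_sub_cancel_left]
          exact hL s hs
      calc |φ w - φ u| = |(φ w - φ v) + (φ v - φ u)| := by ring_nf
        _ ≤ |φ w - φ v| + |φ v - φ u| := abs_add_le _ _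
        _ ≤ L * (p.length + 1) := by linarith

theorem abs_sub_le_of_edist_le {φ : G → ℤ} (hφ : ∀ g h, φ (g * h) = φ g + φ h) {L : ℕ}
    (hL : ∀ s ∈ S, |φ s| ≤ L) {u v : G} {k : ℕ}
    (h : (SimpleGraph.mulCayley S).edist u v ≤ (k : ℕ∞)) : |φ v - φ u| ≤ L * k := by
  obtain ⟨p, hp⟩ := SimpleGraph.exists_walk_of_edist_ne_top
    (ne_top_of_le_ne_top (ENat.natCast_ne_top k) h)
  rw [← hp, Nat.cast_le] at h
  refine (abs_sub_le_of_mem_support hφ hL p v p.end_mem_support).trans ?_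
  gcongr

/-- Concatenating copies of a path for `a`, the walk returns to the level `φ g` after each copy. The
deviation is therefore that of a single copy, whatever `k` is. -/
theorem exists_walk_mulCayley_mul_pow {φ : G → ℤ} (hφ : ∀ g h, φ (g * h) = φ g + φ h) {L : ℕ}
    (hL : ∀ s ∈ S, |φ s| ≤ L) {a : G} (ha : φ a = 0) {m : ℕ}
    (hm : ∀ g : G, ∃ p : (SimpleGraph.mulCayley S).Walk g (g * a), p.length ≤ m) (k : ℕ) (g : G) :
    ∃ p : (SimpleGraph.mulCayley S).Walk g (g * a ^ k), p.length ≤ m * k ∧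
      ∀ w ∈ p.support, |φ w - φ g| ≤ L * m := by
  induction k generalizing g with
  | zero =>
    refine ⟨SimpleGraph.Walk.nil.copy rfl (by simp), by simp, fun w hw => ?_⟩
    simp only [SimpleGraph.Walk.support_copy, SimpleGraph.Walk.support_nil, List.mem_singleton] at hw
    subst hw
    simp only [sub_self, abs_zero]
    positivity
  | succ k ih =>
    obtain ⟨p, hp⟩ := hm g
    obtain ⟨q, hq, hqs⟩ := ih (g * a)
    refine ⟨(p.append q).copy rfl (by rw [pow_succ', mul_assoc]), ?_, fun w hw => ?_⟩
    · rw [SimpleGraph.Walk.length_copy, SimpleGraph.Walk.length_append, mul_add, mul_one]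
      omega
    · rw [SimpleGraph.Walk.support_copy, SimpleGraph.Walk.mem_support_append_iff] at hw
      rcases hw with hw | hw
      · refine (abs_sub_le_of_mem_support hφ hL p w hw).trans ?_
        gcongr
      · simpa [hφ, ha] using hqs w hw

theorem exists_walk_mulCayley_mul_zpow (hS : Subgroup.closure S = ⊤) {φ : G → ℤ}
    (hφ : ∀ g h, φ (g * h) = φ g + φ h) {L : ℕ} (hL : ∀ s ∈ S, |φ s| ≤ L) {a : G} (ha : φ a = 0) :
    ∃ m : ℕ, ∀ (k : ℤ) (g : G), ∃ p : (SimpleGraph.mulCayley S).Walk g (g * a ^ k),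
      p.length ≤ m * k.natAbs ∧ ∀ w ∈ p.support, |φ w - φ g| ≤ L * m := by
  have h1 : φ 1 = 0 := by simpa using hφ 1 1
  have ha' : φ a⁻¹ = 0 := by simpa [h1, ha] using (hφ a a⁻¹).symm
  obtain ⟨m, hm⟩ := exists_walk_mulCayley_mul hS a
  obtain ⟨m', hm'⟩ := exists_walk_mulCayley_mul hS a⁻¹
  refine ⟨max m m', fun k g => ?_⟩
  obtain ⟨n, rfl | rfl⟩ := k.eq_nat_or_neg
  · rw [zpow_natCast]
    exact exists_walk_mulCayley_mul_pow hφ hL ha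
      (fun g => (hm g).imp fun p hp => hp.trans (le_max_left _ _)) n g
  · rw [zpow_neg, zpow_natCast, ← inv_pow, Int.natAbs_neg]
    exact exists_walk_mulCayley_mul_pow hφ hL ha'
      (fun g => (hm' g).imp fun p hp => hp.trans (le_max_right _ _)) n g

end Cayley

/-! ### The robber's strategy -/

/-- Among `n + 1` widely spaced parallel lines, one is far from `n` given points. -/
theorem exists_far_line {n : ℕ} (c : Fin n → ℤ) (Q : ℕ) :
    ∃ j : Fin (n + 1), ∀ i, (Q : ℤ) < |c i - j * (2 * Q + 1)| := by
  by_contra! h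
  -- Pigeonhole: each line is charged to a cop near it, and two lines near the same cop would be at
  -- most `2 * Q` apart.
  choose f hf using h
  obtain ⟨j, k, hne, he⟩ := Fintype.exists_ne_map_eq_of_card_lt f (by simp)
  have h1 := abs_le.1 (hf j)
  have h2 := abs_le.1 (he ▸ hf k)
  refine hne (Fin.ext ?_)
  rcases lt_trichotomy (j : ℕ) (k : ℕ) with h | h | h
  · have : ((j : ℕ) : ℤ) + 1 ≤ (k : ℕ) := by exact_mod_cast h
    nlinarith
  · exact h
  · have : ((k : ℕ) : ℤ) + 1 ≤ (j : ℕ) := by exact_mod_cast h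
    nlinarith

/-- The successive positions of a robber who chooses each position as a function of the current
positions of the cops. -/
def CopStrategy.history {V : Type*} {Γ : SimpleGraph V} {n σ : ℕ} (s : CopStrategy Γ n σ)
    (f : (Fin n → V) → V) : ℕ → List V
  | 0 => []
  | t + 1 => s.history f t ++ [f (s.pos (s.history f t))]

/-- The play and the cops' answers determine each other; recursion on the finite history removes the
circularity. -/
theorem CopStrategy.exists_play {V : Type*} {Γ : SimpleGraph V} {n σ : ℕ} (s : CopStrategy Γ n σ)
    (f : (Fin n → V) → V) : ∃ r : ℕ → V, ∀ t, r t = f (s.at r t) := by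
  refine ⟨fun t => f (s.pos (s.history f t)), fun t => ?_⟩
  have h : ∀ t, (List.range t).map (fun t => f (s.pos (s.history f t))) = s.history f t := by
    intro t
    induction t with
    | zero => rfl
    | succ t ih => rw [List.range_succ, List.map_append, ih]; rfl
  rw [CopStrategy.at, h]

theorem CopStrategy.edist_at_succ_le {V : Type*} {Γ : SimpleGraph V} {n σ : ℕ}
    (s : CopStrategy Γ n σ) (r : ℕ → V) (t : ℕ) (i : Fin n) :
    Γ.edist (s.at r t i) (s.at r (t + 1) i) ≤ (σ : ℕ∞) := by
  rw [CopStrategy.at, CopStrategy.at, List.range_succ, List.map_append]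
  exact s.speed _ _ i

/-- A group that retracts onto `ℤ²` has infinite weak cop number. -/
theorem weakCopNumber_mulCayley_eq_top {G : Type*} [Group G] {S : Set G} (hfin : S.Finite)
    (hS : Subgroup.closure S = ⊤) {φ ψ : G → ℤ} (hφ : ∀ g h, φ (g * h) = φ g + φ h)
    (hψ : ∀ g h, ψ (g * h) = ψ g + ψ h) {a b : G} (hab : Commute a b)
    (hφa : φ a = 1) (hψa : ψ a = 0) (hφb : φ b = 0) (hψb : ψ b = 1) :
    weakCopNumber (SimpleGraph.mulCayley S) = ⊤ := by
  rw [weakCopNumber, sInf_eq_top]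
  rintro _ ⟨n, ⟨σ, -, ρ, -, hwin⟩, rfl⟩
  exfalso
  obtain ⟨L, hLφ, hLψ⟩ : ∃ L : ℕ, (∀ s ∈ S, |φ s| ≤ L) ∧ ∀ s ∈ S, |ψ s| ≤ L := by
    obtain ⟨L, hL⟩ := (hfin.image fun s => (φ s).natAbs).bddAbove
    obtain ⟨L', hL'⟩ := (hfin.image fun s => (ψ s).natAbs).bddAbove
    refine ⟨max L L', fun s hs => ?_, fun s hs => ?_⟩
    · have h : (φ s).natAbs ≤ L := hL (Set.mem_image_of_mem _ hs)
      rw [Int.abs_eq_natAbs]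
      exact_mod_cast h.trans (le_max_left _ _)
    · have h : (ψ s).natAbs ≤ L' := hL' (Set.mem_image_of_mem _ hs)
      rw [Int.abs_eq_natAbs]
      exact_mod_cast h.trans (le_max_right _ _)
  obtain ⟨m, hm⟩ := exists_walk_mulCayley_mul_zpow hS hψ hLψ hψa
  obtain ⟨k, hk⟩ := exists_walk_mulCayley_mul_zpow hS hφ hLφ hφb
  -- a vertex within reach of a cop is at distance at most `L * ρ` from it in each coordinate
  set Q : ℕ := L * ρ + L * m + L * k + L * σ with hQ
  -- An L-shaped path inside the grid has at most `n * (2 * Q + 1)` steps in each direction, costing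
  -- at most `m` edges per `a` and `k` per `b`.
  set N : ℕ := (m + k) * (n * (2 * Q + 1)) with hN
  have hzpow : ∀ (χ : G → ℤ), (∀ g h, χ (g * h) = χ g + χ h) → ∀ (g : G) (j : ℤ),
      χ (g ^ j) = j * χ g := fun χ hχ g j => by
    let χ' : G →* Multiplicative ℤ := MonoidHom.mk' (fun g => Multiplicative.ofAdd (χ g))
      fun g h => by rw [hχ]; rfl
    have := congrArg Multiplicative.toAdd (map_zpow χ' g j)
    simpa [χ'] using this
  -- The margin `Q` pays for the reach (`L * ρ`), for the wobble of paths in the directions `a` and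
  -- `b` (`L * m`, `L * k`) and for one turn of the cops (`L * σ`).
  choose col hcol using fun c : Fin n → G => exists_far_line (fun i => φ (c i)) Q
  choose row hrow using fun c : Fin n → G => exists_far_line (fun i => ψ (c i)) Q
  let x : (Fin n → G) → ℤ := fun c => col c * (2 * Q + 1)
  let y : (Fin n → G) → ℤ := fun c => row c * (2 * Q + 1)
  have hx : ∀ c, 0 ≤ x c ∧ x c ≤ n * (2 * Q + 1) := fun c =>
    ⟨by positivity, mul_le_mul_of_nonneg_right (by exact_mod_cast Fin.is_le (col c)) (by positivity)⟩
  have hy : ∀ c, 0 ≤ y c ∧ y c ≤ n * (2 * Q + 1) := fun c =>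
    ⟨by positivity, mul_le_mul_of_nonneg_right (by exact_mod_cast Fin.is_le (row c)) (by positivity)⟩
  -- `N` bounds both the robber's moves and his distance from the identity, so it serves as speed
  -- and as radius; the successor makes it positive.
  obtain ⟨s, hs⟩ := hwin (N + 1) N.succ_pos (N + 1) N.succ_pos 1
  obtain ⟨r, hr⟩ := s.exists_play fun c => a ^ x c * b ^ y c
  have hφab : ∀ i j : ℤ, φ (a ^ i * b ^ j) = i := fun i j => by
    rw [hφ, hzpow φ hφ, hzpow φ hφ, hφa, hφb]; ring
  have hψab : ∀ i j : ℤ, ψ (a ^ i * b ^ j) = j := fun i j => by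
    rw [hψ, hzpow ψ hψ, hzpow ψ hψ, hψa, hψb]; ring
  have hwalk : ∀ i j i' j' : ℤ, |i' - i| ≤ n * (2 * Q + 1) → |j' - j| ≤ n * (2 * Q + 1) →
      ∃ p : (SimpleGraph.mulCayley S).Walk (a ^ i * b ^ j) (a ^ i' * b ^ j'),
        p.length ≤ N ∧ ∀ w ∈ p.support, |φ w - i| ≤ L * k ∨ |ψ w - j'| ≤ L * m := by
    intro i j i' j' hi hj
    obtain ⟨p, hp, hps⟩ := hk (j' - j) (a ^ i * b ^ j)
    obtain ⟨q, hq, hqs⟩ := hm (i' - i) (a ^ i * b ^ j')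
    have e1 : a ^ i * b ^ j * b ^ (j' - j) = a ^ i * b ^ j' := by
      rw [mul_assoc, ← zpow_add, add_sub_cancel]
    have e2 : a ^ i * b ^ j' * a ^ (i' - i) = a ^ i' * b ^ j' := by
      rw [mul_assoc, ← ((hab.zpow_zpow (i' - i) j').eq), ← mul_assoc, ← zpow_add, add_sub_cancel]
    refine ⟨(p.copy rfl e1).append (q.copy rfl e2), ?_, fun w hw => ?_⟩
    · rw [SimpleGraph.Walk.length_append, SimpleGraph.Walk.length_copy,
        SimpleGraph.Walk.length_copy]
      have hi' : (i' - i).natAbs ≤ n * (2 * Q + 1) := by zify; exact hi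
      have hj' : (j' - j).natAbs ≤ n * (2 * Q + 1) := by zify; exact hj
      have h1 := hp.trans (Nat.mul_le_mul_left k hj')
      have h2 := hq.trans (Nat.mul_le_mul_left m hi')
      rw [hN, add_mul]
      omega
    · rw [SimpleGraph.Walk.mem_support_append_iff, SimpleGraph.Walk.support_copy,
        SimpleGraph.Walk.support_copy] at hw
      rcases hw with hw | hw
      · exact Or.inl (by simpa only [hφab] using hps w hw)
      · exact Or.inr (by simpa only [hψab] using hqs w hw)
  -- The column was chosen before the cops' turn, so `L * σ` of its margin is spent here.
  have hφc : ∀ t i, (L * ρ + L * m + L * k : ℤ) < |φ (s.at r (t + 1) i) - x (s.at r t)| := by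
    intro t i
    have h1 := hcol (s.at r t) i
    have h2 := abs_sub_le_of_edist_le hφ hLφ (s.edist_at_succ_le r t i)
    have h3 := abs_sub_abs_le_abs_sub (φ (s.at r t i) - x (s.at r t))
      (φ (s.at r t i) - φ (s.at r (t + 1) i))
    rw [sub_sub_sub_cancel_left, abs_sub_comm (φ (s.at r t i)) (φ (s.at r (t + 1) i))] at h3
    rw [hQ] at h1
    push_cast at h1
    simp only [x] at h3 ⊢
    rw [hQ] at h3 ⊢
    push_cast at h3 ⊢
    linarith
  -- The first alternative is the leg along the old column, the second the leg along the row chosen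
  -- after the cops' turn.
  have hfree : ∀ t w, (|φ w - x (s.at r t)| ≤ L * k ∨ |ψ w - y (s.at r (t + 1))| ≤ L * m) →
      ¬ InReach (SimpleGraph.mulCayley S) ρ (s.at r (t + 1)) w := by
    rintro t w hw ⟨i, hi⟩
    have hLk : (0 : ℤ) ≤ L * k := by positivity
    have hLm : (0 : ℤ) ≤ L * m := by positivity
    have hLσ : (0 : ℤ) ≤ L * σ := by positivity
    rcases hw with hw | hw
    · have h1 := hφc t i
      have h2 := abs_sub_le_of_edist_le hφ hLφ hi
      have h3 := abs_sub_le (φ (s.at r (t + 1) i)) (φ w) (x (s.at r t))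
      rw [abs_sub_comm (φ (s.at r (t + 1) i)) (φ w)] at h3
      linarith
    · have h1 : (Q : ℤ) < |ψ (s.at r (t + 1) i) - y (s.at r (t + 1))| := hrow (s.at r (t + 1)) i
      have h2 := abs_sub_le_of_edist_le hψ hLψ hi
      have h3 := abs_sub_le (ψ (s.at r (t + 1) i)) (ψ w) (y (s.at r (t + 1)))
      rw [abs_sub_comm (ψ (s.at r (t + 1) i)) (ψ w)] at h3
      have h4 : (Q : ℤ) = L * ρ + L * m + L * k + L * σ := by rw [hQ]; push_cast; ring
      linarith
  have habs : ∀ u v : ℤ, 0 ≤ u ∧ u ≤ n * (2 * Q + 1) → 0 ≤ v ∧ v ≤ n * (2 * Q + 1) →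
      |u - v| ≤ n * (2 * Q + 1) := fun u v hu hv => abs_le.2 ⟨by linarith, by linarith⟩
  have hplay : IsRobberPlay ρ (N + 1) s r := by
    intro t _
    obtain ⟨p, hp, hps⟩ := hwalk (x (s.at r t)) (y (s.at r t)) (x (s.at r (t + 1)))
      (y (s.at r (t + 1))) (habs _ _ (hx _) (hx _)) (habs _ _ (hy _) (hy _))
    rw [hr t, hr (t + 1)]
    refine ⟨(SimpleGraph.edist_le p).trans (by exact_mod_cast hp.trans N.le_succ), p, fun w hw => ?_⟩
    exact hfree t w (hps w hw)
  rcases hs r hplay with ⟨t, ht⟩ | ⟨T, hT⟩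
  · refine hfree t (r t) (Or.inl ?_) ht
    rw [hr t, hφab, sub_self, abs_zero]
    positivity
  · refine hT T le_rfl ?_
    obtain ⟨p, hp, -⟩ := hwalk 0 0 (x (s.at r T)) (y (s.at r T))
      (habs _ _ (hx _) ⟨le_rfl, by positivity⟩) (habs _ _ (hy _) ⟨le_rfl, by positivity⟩)
    rw [hr T]
    have h := SimpleGraph.edist_le (p.copy (show a ^ (0 : ℤ) * b ^ (0 : ℤ) = 1 by simp) rfl)
    rw [SimpleGraph.Walk.length_copy] at h
    exact h.trans (by exact_mod_cast hp.trans N.le_succ)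

end WeakCops

/-! ### Elements of F as real functions -/

namespace Thompson

open Filter Topology

/-- The function `[0, 1] → [0, 1]`, as a function on the real line. -/
noncomputable def toReal (g : unitInterval ≃ₜ unitInterval) (x : ℝ) : ℝ :=
  g (Set.projIcc 0 1 zero_le_one x)

theorem toReal_coe (g : unitInterval ≃ₜ unitInterval) (x : unitInterval) :
    toReal g x = g x := by
  rw [toReal, Set.projIcc_val]

theorem toReal_mem (g : unitInterval ≃ₜ unitInterval) (x : ℝ) : toReal g x ∈ Set.Icc (0 : ℝ) 1 :=
  (g _).2

theorem toReal_mul (f g : unitInterval ≃ₜ unitInterval) (x : ℝ) :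
    toReal (f * g) x = toReal f (toReal g x) := by
  rw [toReal, toReal, toReal, Set.projIcc_val]
  rfl

theorem toReal_one {x : ℝ} (hx : x ∈ Set.Icc (0 : ℝ) 1) : toReal 1 x = x := by
  rw [toReal, Set.projIcc_of_mem _ hx]
  rfl

theorem toReal_inv_toReal (g : unitInterval ≃ₜ unitInterval) {x : ℝ} (hx : x ∈ Set.Icc (0 : ℝ) 1) :
    toReal g⁻¹ (toReal g x) = x := by
  rw [← toReal_mul, inv_mul_cancel, toReal_one hx]

theorem toReal_toReal_inv (g : unitInterval ≃ₜ unitInterval) {x : ℝ} (hx : x ∈ Set.Icc (0 : ℝ) 1) :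
    toReal g (toReal g⁻¹ x) = x := by
  rw [← toReal_mul, mul_inv_cancel, toReal_one hx]

theorem toReal_ext {f g : unitInterval ≃ₜ unitInterval}
    (h : ∀ x ∈ Set.Icc (0 : ℝ) 1, toReal f x = toReal g x) : f = g := by
  ext x
  rw [← toReal_coe, ← toReal_coe]
  exact h x x.2

theorem toReal_strictMonoOn {g : unitInterval ≃ₜ unitInterval} (hg : StrictMono g) :
    StrictMonoOn (toReal g) (Set.Icc 0 1) := fun x hx y hy hxy => by
  rw [toReal, toReal, Set.projIcc_of_mem _ hx, Set.projIcc_of_mem _ hy]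
  exact hg hxy

theorem toReal_zero {g : unitInterval ≃ₜ unitInterval} (hg : StrictMono g) : toReal g 0 = 0 := by
  rw [show (0 : ℝ) = ((0 : unitInterval) : ℝ) from rfl, toReal_coe, map_zero_of_strictMono g hg]

theorem map_one_of_strictMono {g : unitInterval ≃ₜ unitInterval} (hg : StrictMono g) : g 1 = 1 := by
  refine le_antisymm unitInterval.le_one' ?_
  have h : g (g.symm 1) ≤ g 1 := hg.monotone unitInterval.le_one'
  rwa [g.apply_symm_apply] at h

theorem toReal_map_one {g : unitInterval ≃ₜ unitInterval} (hg : StrictMono g) :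
    toReal g 1 = 1 := by
  rw [show (1 : ℝ) = ((1 : unitInterval) : ℝ) from rfl, toReal_coe, map_one_of_strictMono hg]

/-- A real function that restricts to a dyadic piecewise linear function on `[0, 1]`. -/
def IsDyadicPLOn (u : ℝ → ℝ) : Prop :=
  ∃ D : Finset ℝ, (∀ d ∈ D, IsDyadic d) ∧
    ∀ a ∈ Set.Icc (0 : ℝ) 1, ∀ b ∈ Set.Icc (0 : ℝ) 1, a < b → (∀ d ∈ D, ¬ (a < d ∧ d < b)) →
      ∃ m : ℤ, ∀ x ∈ Set.Icc a b, u x - u a = (2 : ℝ) ^ m * (x - a)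

theorem isDyadicPL_iff (g : unitInterval ≃ₜ unitInterval) :
    IsDyadicPL g ↔ IsDyadicPLOn (toReal g) := by
  classical
  constructor
  · rintro ⟨D, hD, h⟩
    refine ⟨D.image (↑), by simpa using fun d h1 h2 => hD ⟨d, h1⟩ h2, fun a ha b hb _ hab => ?_⟩
    obtain ⟨m, hm⟩ := h ⟨a, ha⟩ ⟨b, hb⟩ fun d hd => hab d (Finset.mem_image_of_mem _ hd)
    refine ⟨m, fun x hx => ?_⟩
    have hx' : x ∈ Set.Icc (0 : ℝ) 1 := ⟨ha.1.trans hx.1, hx.2.trans hb.2⟩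
    have h1 := hm ⟨x, hx'⟩ hx
    rwa [← toReal_coe, ← toReal_coe] at h1
  · rintro ⟨D, hD, h⟩
    refine ⟨D.subtype (· ∈ unitInterval), fun d hd => hD d (Finset.mem_subtype.1 hd),
      fun a b hab => ?_⟩
    rcases lt_or_ge a b with hlt | hle
    · obtain ⟨m, hm⟩ := h a a.2 b b.2 hlt fun d hd hdd =>
        hab ⟨d, a.2.1.trans hdd.1.le, hdd.2.le.trans b.2.2⟩ (Finset.mem_subtype.2 hd) hdd
      refine ⟨m, fun x hx => ?_⟩
      rw [← toReal_coe, ← toReal_coe]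
      exact hm x hx
    · refine ⟨0, fun x hx => ?_⟩
      rw [le_antisymm (hx.2.trans hle) hx.1]
      simp

/-- A homeomorphism of the unit interval, from a pair of inverse real functions. -/
noncomputable def homeoOfReal (u v : ℝ → ℝ) (hu : Set.MapsTo u (Set.Icc 0 1) (Set.Icc 0 1))
    (hv : Set.MapsTo v (Set.Icc 0 1) (Set.Icc 0 1))
    (huv : Set.LeftInvOn u v (Set.Icc 0 1)) (hmono : StrictMonoOn u (Set.Icc 0 1)) :
    unitInterval ≃ₜ unitInterval :=
  -- A strictly monotone map with a right inverse is an order isomorphism, so continuity in both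
  -- directions comes from the order topology.
  (StrictMono.orderIsoOfRightInverse (fun x : unitInterval => (⟨u x, hu x.2⟩ : unitInterval))
    (fun x y hxy => hmono x.2 y.2 hxy) (fun x => ⟨v x, hv x.2⟩)
    (fun x => Subtype.ext (huv x.2))).toHomeomorph

section homeoOfReal

variable {u v : ℝ → ℝ} (hu : Set.MapsTo u (Set.Icc 0 1) (Set.Icc 0 1))
    (hv : Set.MapsTo v (Set.Icc 0 1) (Set.Icc 0 1))
    (huv : Set.LeftInvOn u v (Set.Icc 0 1)) (hmono : StrictMonoOn u (Set.Icc 0 1))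

theorem toReal_homeoOfReal {x : ℝ} (hx : x ∈ Set.Icc (0 : ℝ) 1) :
    toReal (homeoOfReal u v hu hv huv hmono) x = u x := by
  rw [toReal, Set.projIcc_of_mem _ hx]
  rfl

theorem homeoOfReal_mem (hpl : IsDyadicPLOn u) :
    homeoOfReal u v hu hv huv hmono ∈ F := by
  refine ⟨fun x y hxy => hmono x.2 y.2 hxy, (isDyadicPL_iff _).2 ?_⟩
  obtain ⟨D, hD, h⟩ := hpl
  refine ⟨D, hD, fun a ha b hb hlt hab => ?_⟩
  obtain ⟨m, hm⟩ := h a ha b hb hlt hab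
  refine ⟨m, fun x hx => ?_⟩
  rw [toReal_homeoOfReal _ _ _ _ ha,
    toReal_homeoOfReal _ _ _ _ ⟨ha.1.trans hx.1, hx.2.trans hb.2⟩]
  exact hm x hx

end homeoOfReal

/-! ### The generator `x₀` -/

/-- The generator `x₀`, as a real function. -/
noncomputable def x₀Fun (x : ℝ) : ℝ :=
  if x ≤ 1 / 4 then 2 * x else if x ≤ 1 / 2 then x + 1 / 4 else (x + 1) / 2

/-- The inverse of `x₀`, as a real function. -/
noncomputable def x₀InvFun (x : ℝ) : ℝ :=
  if x ≤ 1 / 2 then x / 2 else if x ≤ 3 / 4 then x - 1 / 4 else 2 * x - 1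

theorem x₀Fun_strictMono : StrictMono x₀Fun := fun x y hxy => by
  unfold x₀Fun
  split_ifs <;> linarith

theorem x₀Fun_x₀InvFun (x : ℝ) : x₀Fun (x₀InvFun x) = x := by
  unfold x₀InvFun x₀Fun
  split_ifs <;> linarith

theorem isDyadicPLOn_x₀Fun : IsDyadicPLOn x₀Fun := by
  refine ⟨{1 / 4, 1 / 2}, ?_, fun a ha b hb hlt hab => ?_⟩
  · simp only [Finset.mem_insert, Finset.mem_singleton, forall_eq_or_imp, forall_eq]
    exact ⟨⟨1, 2, by norm_num⟩, ⟨1, 1, by norm_num⟩⟩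
  · simp only [Finset.mem_insert, Finset.mem_singleton, forall_eq_or_imp, forall_eq, not_and,
      not_lt] at hab
    obtain ⟨h1, h2⟩ := hab
    rcases lt_or_ge a (1 / 4) with h | h
    · refine ⟨1, fun x hx => ?_⟩
      have hb := h1 h
      rw [x₀Fun, if_pos (hx.2.trans hb), x₀Fun, if_pos h.le, zpow_one]
      ring
    rcases lt_or_ge a (1 / 2) with h' | h'
    · refine ⟨0, fun x ⟨hx, hx'⟩ => ?_⟩
      have hb := h2 h'
      unfold x₀Fun
      split_ifs <;> norm_num <;> linarith
    · refine ⟨-1, fun x ⟨hx, hx'⟩ => ?_⟩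
      unfold x₀Fun
      split_ifs <;> norm_num <;> linarith

/-- The generator `x₀` of Thompson's group. -/
noncomputable def x₀ : F :=
  ⟨homeoOfReal x₀Fun x₀InvFun
    (fun x ⟨h, h'⟩ => by unfold x₀Fun; constructor <;> split_ifs <;> linarith)
    (fun x ⟨h, h'⟩ => by unfold x₀InvFun; constructor <;> split_ifs <;> linarith)
    (fun x _ => x₀Fun_x₀InvFun x) (x₀Fun_strictMono.strictMonoOn _),
    homeoOfReal_mem _ _ _ _ isDyadicPLOn_x₀Fun⟩

theorem toReal_x₀ {x : ℝ} (hx : x ∈ Set.Icc (0 : ℝ) 1) : toReal x₀ x = x₀Fun x := by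
  rw [toReal, Set.projIcc_of_mem _ hx]
  rfl

/-! ### Commuting copies of F on the two halves -/

/-- The function which acts as `u` on `[0, 1/2]` and as `v` on `[1/2, 1]`. -/
noncomputable def halvesFun (u v : ℝ → ℝ) (x : ℝ) : ℝ :=
  if x ≤ 1 / 2 then u (2 * x) / 2 else (v (2 * x - 1) + 1) / 2

theorem halvesFun_of_le {u v : ℝ → ℝ} {x : ℝ} (hx : x ≤ 1 / 2) :
    halvesFun u v x = u (2 * x) / 2 := if_pos hx

theorem halvesFun_of_ge {u v : ℝ → ℝ} (hu : u 1 = 1) (hv : v 0 = 0) {x : ℝ} (hx : 1 / 2 ≤ x) :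
    halvesFun u v x = (v (2 * x - 1) + 1) / 2 := by
  rcases hx.eq_or_lt with rfl | hx
  · rw [halvesFun_of_le le_rfl]
    norm_num [hu, hv]
  · exact if_neg hx.not_ge

section halves

variable {u v u' v' : ℝ → ℝ}

theorem halvesFun_mapsTo (hu : Set.MapsTo u (Set.Icc 0 1) (Set.Icc 0 1))
    (hv : Set.MapsTo v (Set.Icc 0 1) (Set.Icc 0 1)) :
    Set.MapsTo (halvesFun u v) (Set.Icc 0 1) (Set.Icc 0 1) := by
  rintro x ⟨h0, h1⟩
  unfold halvesFun
  split_ifs with h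
  · have := hu (x := 2 * x) ⟨by linarith, by linarith⟩
    exact ⟨by linarith [this.1], by linarith [this.2]⟩
  · have := hv (x := 2 * x - 1) ⟨by linarith, by linarith⟩
    exact ⟨by linarith [this.1], by linarith [this.2]⟩

theorem halvesFun_comp (hu : Set.MapsTo u (Set.Icc 0 1) (Set.Icc 0 1))
    (hv : Set.MapsTo v (Set.Icc 0 1) (Set.Icc 0 1)) (hu1 : u' 1 = 1) (hv0 : v' 0 = 0)
    {x : ℝ} (hx : x ∈ Set.Icc (0 : ℝ) 1) :
    halvesFun u' v' (halvesFun u v x) = halvesFun (u' ∘ u) (v' ∘ v) x := by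
  rcases le_or_gt x (1 / 2) with h | h
  · have := hu (x := 2 * x) ⟨by linarith [hx.1], by linarith⟩
    rw [halvesFun_of_le h, halvesFun_of_le (by linarith [this.2]), halvesFun_of_le h,
      mul_div_cancel₀ _ two_ne_zero]
    rfl
  · have := hv (x := 2 * x - 1) ⟨by linarith, by linarith [hx.2]⟩
    have h1 : halvesFun u v x = (v (2 * x - 1) + 1) / 2 := if_neg h.not_ge
    rw [h1, halvesFun_of_ge hu1 hv0 (by linarith [this.1]), mul_div_cancel₀ _ two_ne_zero,
      add_sub_cancel_right, halvesFun, if_neg h.not_ge]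
    rfl

theorem halvesFun_of_eqOn_id (hu : ∀ x ∈ Set.Icc (0 : ℝ) 1, u x = x)
    (hv : ∀ x ∈ Set.Icc (0 : ℝ) 1, v x = x) {x : ℝ} (hx : x ∈ Set.Icc (0 : ℝ) 1) :
    halvesFun u v x = x := by
  unfold halvesFun
  split_ifs with h
  · rw [hu _ ⟨by linarith [hx.1], by linarith⟩]
    ring
  · rw [hv _ ⟨by linarith, by linarith [hx.2]⟩]
    ring

theorem halvesFun_strictMonoOn (hu : StrictMonoOn u (Set.Icc 0 1))
    (hv : StrictMonoOn v (Set.Icc 0 1)) (hu1 : u 1 = 1) (hv0 : v 0 = 0) :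
    StrictMonoOn (halvesFun u v) (Set.Icc 0 1) := by
  rintro x ⟨hx0, hx1⟩ y ⟨hy0, hy1⟩ hxy
  rcases le_or_gt y (1 / 2) with h | h
  · rw [halvesFun_of_le h, halvesFun_of_le (hxy.le.trans h)]
    linarith [hu (a := 2 * x) ⟨by linarith, by linarith⟩ (b := 2 * y)
      ⟨by linarith, by linarith⟩ (by linarith)]
  rcases le_or_gt (1 / 2) x with h' | h'
  · rw [halvesFun_of_ge hu1 hv0 h', halvesFun_of_ge hu1 hv0 h.le]
    linarith [hv (a := 2 * x - 1) ⟨by linarith, by linarith⟩ (b := 2 * y - 1)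
      ⟨by linarith, by linarith⟩ (by linarith)]
  · rw [halvesFun_of_le h'.le, halvesFun_of_ge hu1 hv0 h.le]
    have h1 := hu (a := 2 * x) ⟨by linarith, by linarith⟩ (b := 1) ⟨by simp, le_rfl⟩ (by linarith)
    have h2 := hv (a := 0) ⟨le_rfl, by simp⟩ (b := 2 * y - 1) ⟨by linarith, by linarith⟩
      (by linarith)
    linarith

theorem isDyadicPLOn_halvesFun (hu : IsDyadicPLOn u) (hv : IsDyadicPLOn v) (hu1 : u 1 = 1)
    (hv0 : v 0 = 0) : IsDyadicPLOn (halvesFun u v) := by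
  classical
  obtain ⟨D, hD, hD'⟩ := hu
  obtain ⟨E, hE, hE'⟩ := hv
  have hhalf : IsDyadic (1 / 2) := ⟨1, 1, by norm_num⟩
  refine ⟨insert (1 / 2) (D.image (fun d => d / 2) ∪ E.image (fun d => (d + 1) / 2)), ?_, ?_⟩
  · intro d hd
    rw [Finset.mem_insert, Finset.mem_union, Finset.mem_image, Finset.mem_image] at hd
    obtain rfl | ⟨d, hd, rfl⟩ | ⟨d, hd, rfl⟩ := hd
    · exact hhalf
    · convert (hD d hd).zpow_mul (-1) using 1
      norm_num
      ring
    · convert ((hE d hd).zpow_mul (-1)).add hhalf using 1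
      norm_num
      ring
  · intro a ha b hb hlt hab
    have h0 := hab _ (Finset.mem_insert_self _ _)
    rw [not_and, not_lt] at h0
    rcases lt_or_ge a (1 / 2) with h | h
    · have hb' := h0 h
      obtain ⟨m, hm⟩ := hD' (2 * a) ⟨by linarith [ha.1], by linarith⟩ (2 * b)
        ⟨by linarith [hb.1], by linarith⟩ (by linarith) fun d hd hdd =>
          hab (d / 2) (Finset.mem_insert_of_mem (Finset.mem_union_left _
            (Finset.mem_image_of_mem _ hd))) ⟨by linarith [hdd.1], by linarith [hdd.2]⟩
      refine ⟨m, fun x hx => ?_⟩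
      rw [halvesFun_of_le (hx.2.trans hb'), halvesFun_of_le h.le]
      linarith [hm (2 * x) ⟨by linarith [hx.1], by linarith [hx.2]⟩]
    · obtain ⟨m, hm⟩ := hE' (2 * a - 1) ⟨by linarith, by linarith [ha.2]⟩ (2 * b - 1)
        ⟨by linarith, by linarith [hb.2]⟩ (by linarith) fun d hd hdd =>
          hab ((d + 1) / 2) (Finset.mem_insert_of_mem (Finset.mem_union_right _
            (Finset.mem_image_of_mem _ hd))) ⟨by linarith [hdd.1], by linarith [hdd.2]⟩
      refine ⟨m, fun x hx => ?_⟩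
      rw [halvesFun_of_ge hu1 hv0 (h.trans hx.1), halvesFun_of_ge hu1 hv0 h]
      linarith [hm (2 * x - 1) ⟨by linarith [hx.1], by linarith [hx.2]⟩]

end halves

/-- The pair `(g, h)` acting as `g` on `[0, 1/2]` and as `h` on `[1/2, 1]`. -/
noncomputable def halvesElem (g h : F) : F :=
  have H : ∀ g h : F, Set.LeftInvOn (halvesFun (toReal ↑g⁻¹) (toReal ↑h⁻¹))
      (halvesFun (toReal g) (toReal h)) (Set.Icc 0 1) := fun g h x hx => by
    rw [halvesFun_comp (fun _ _ => toReal_mem _ _) (fun _ _ => toReal_mem _ _)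
      (toReal_map_one (g⁻¹).2.1) (toReal_zero (h⁻¹).2.1) hx]
    exact halvesFun_of_eqOn_id (fun x hx => toReal_inv_toReal _ hx)
      (fun x hx => toReal_inv_toReal _ hx) hx
  ⟨homeoOfReal (halvesFun (toReal g) (toReal h)) (halvesFun (toReal ↑g⁻¹) (toReal ↑h⁻¹))
    (halvesFun_mapsTo (fun _ _ => toReal_mem _ _) (fun _ _ => toReal_mem _ _))
    (halvesFun_mapsTo (fun _ _ => toReal_mem _ _) (fun _ _ => toReal_mem _ _))
    (by simpa only [inv_inv] using H g⁻¹ h⁻¹)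
    (halvesFun_strictMonoOn (toReal_strictMonoOn g.2.1) (toReal_strictMonoOn h.2.1)
      (toReal_map_one g.2.1) (toReal_zero h.2.1)),
    homeoOfReal_mem _ _ _ _ (isDyadicPLOn_halvesFun ((isDyadicPL_iff _).1 g.2.2)
      ((isDyadicPL_iff _).1 h.2.2) (toReal_map_one g.2.1) (toReal_zero h.2.1))⟩

theorem toReal_halvesElem (g h : F) {x : ℝ} (hx : x ∈ Set.Icc (0 : ℝ) 1) :
    toReal (halvesElem g h) x = halvesFun (toReal g) (toReal h) x := by
  rw [toReal, Set.projIcc_of_mem _ hx]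
  rfl

theorem F_ext {f g : F} (h : ∀ x ∈ Set.Icc (0 : ℝ) 1, toReal f x = toReal g x) : f = g :=
  Subtype.ext (toReal_ext h)

/-- The embedding of `F × F` into `F` by the action on the two halves of the interval. -/
noncomputable def halves : F × F →* F :=
  MonoidHom.mk' (fun p => halvesElem p.1 p.2) fun p q => F_ext fun x hx => by
    rw [Subgroup.coe_mul, toReal_mul, toReal_halvesElem _ _ hx, toReal_halvesElem _ _ hx,
      toReal_halvesElem _ _ (halvesFun_mapsTo (fun _ _ => toReal_mem _ _)
        (fun _ _ => toReal_mem _ _) hx),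
      halvesFun_comp (fun _ _ => toReal_mem _ _) (fun _ _ => toReal_mem _ _)
        (toReal_map_one p.1.2.1) (toReal_zero p.2.2.1) hx]
    simp only [halvesFun, Prod.fst_mul, Prod.snd_mul, Subgroup.coe_mul, toReal_mul,
      Function.comp_apply]

theorem toReal_halves (g h : F) {x : ℝ} (hx : x ∈ Set.Icc (0 : ℝ) 1) :
    toReal (halves (g, h)) x = halvesFun (toReal g) (toReal h) x :=
  toReal_halvesElem g h hx

theorem toReal_halves_left (g h : F) {x : ℝ} (hx : x ∈ Set.Icc (0 : ℝ) (1 / 2)) :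
    toReal (halves (g, h)) x = toReal g (2 * x) / 2 := by
  rw [toReal_halves g h ⟨hx.1, by linarith [hx.2]⟩, halvesFun_of_le hx.2]

theorem toReal_halves_right (g h : F) {x : ℝ} (hx : x ∈ Set.Icc (1 / 2 : ℝ) 1) :
    toReal (halves (g, h)) x = (toReal h (2 * x - 1) + 1) / 2 := by
  rw [toReal_halves g h ⟨by linarith [hx.1], hx.2⟩,
    halvesFun_of_ge (toReal_map_one g.2.1) (toReal_zero h.2.1) hx.1]

/-! ### Slopes at the endpoints and the retraction onto ℤ² -/

/-- Near the point `e` the function `g` is affine of slope `2 ^ m` and fixes `e`. -/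
def HasLogSlope (e : ℝ) (g : F) (m : ℤ) : Prop :=
  ∀ᶠ x in 𝓝[Set.Icc 0 1] e, toReal g x - e = (2 : ℝ) ^ m * (x - e)

theorem continuous_toReal (g : unitInterval ≃ₜ unitInterval) : Continuous (toReal g) :=
  continuous_subtype_val.comp (g.continuous.comp continuous_projIcc)

/-- The point `e` is not isolated in the interval, so the two affine formulas can be compared at
some `x ≠ e`. -/
theorem HasLogSlope.unique {e : ℝ} (he : e ∈ Set.Icc (0 : ℝ) 1) {g : F} {m k : ℤ}
    (hm : HasLogSlope e g m) (hk : HasLogSlope e g k) : m = k := by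
  have hacc := (isPreconnected_Icc (a := (0 : ℝ)) (b := 1)).preperfect_of_nontrivial
    ⟨0, Set.left_mem_Icc.2 zero_le_one, 1, Set.right_mem_Icc.2 zero_le_one, zero_ne_one⟩ e he
  obtain ⟨x, ⟨hxe, hx⟩, h1, h2⟩ := ((accPt_iff_frequently.1 hacc).and_eventually
    ((eventually_nhdsWithin_iff.1 hm).and (eventually_nhdsWithin_iff.1 hk))).exists
  have h3 := (h1 hx).symm.trans (h2 hx)
  exact zpow_right_injective₀ zero_lt_two (by norm_num)
    (mul_right_cancel₀ (sub_ne_zero.2 hxe) h3)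

theorem HasLogSlope.mul {e : ℝ} {f g : F} {m k : ℤ} (hg : toReal g e = e)
    (hm : HasLogSlope e f m) (hk : HasLogSlope e g k) : HasLogSlope e (f * g) (m + k) := by
  have ht : Tendsto (toReal g) (𝓝[Set.Icc 0 1] e) (𝓝[Set.Icc 0 1] e) := by
    refine tendsto_nhdsWithin_iff.2 ⟨?_, Eventually.of_forall fun x => toReal_mem _ x⟩
    simpa only [hg] using ((continuous_toReal g).tendsto e).mono_left nhdsWithin_le_nhds
  filter_upwards [ht.eventually hm, hk] with x h1 h2
  rw [Subgroup.coe_mul, toReal_mul, h1, h2, ← mul_assoc, ← zpow_add₀ two_ne_zero]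

theorem exists_hasLogSlope_zero (g : F) : ∃ m, HasLogSlope 0 g m := by
  obtain ⟨D, -, h⟩ := (isDyadicPL_iff _).1 g.2.2
  have hev : ∀ᶠ b in 𝓝[>] (0 : ℝ), ∀ d ∈ D, ¬ (0 < d ∧ d < b) := by
    refine D.eventually_all.2 fun d _ => ?_
    rcases lt_or_ge 0 d with hd | hd
    · filter_upwards [nhdsWithin_le_nhds (Iio_mem_nhds hd)] with b hb h
      exact lt_asymm h.2 hb
    · exact Eventually.of_forall fun b h => hd.not_gt h.1
  obtain ⟨b, hb, hb1, hb0⟩ := (hev.and (((eventually_lt_nhds (zero_lt_one' ℝ)).filter_mono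
    nhdsWithin_le_nhds).and eventually_mem_nhdsWithin)).exists
  obtain ⟨m, hm⟩ := h 0 ⟨le_rfl, zero_le_one⟩ b ⟨le_of_lt hb0, le_of_lt hb1⟩ hb0 hb
  refine ⟨m, ?_⟩
  filter_upwards [self_mem_nhdsWithin, nhdsWithin_le_nhds (Iio_mem_nhds hb0)] with x hx hxb
  simpa only [toReal_zero g.2.1] using hm x ⟨hx.1, le_of_lt hxb⟩

theorem exists_hasLogSlope_one (g : F) : ∃ m, HasLogSlope 1 g m := by
  obtain ⟨D, -, h⟩ := (isDyadicPL_iff _).1 g.2.2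
  have hev : ∀ᶠ a in 𝓝[<] (1 : ℝ), ∀ d ∈ D, ¬ (a < d ∧ d < 1) := by
    refine D.eventually_all.2 fun d _ => ?_
    rcases lt_or_ge d 1 with hd | hd
    · filter_upwards [nhdsWithin_le_nhds (Ioi_mem_nhds hd)] with a ha h
      exact lt_asymm h.1 ha
    · exact Eventually.of_forall fun b h => hd.not_gt h.2
  obtain ⟨a, ha, ha0, ha1⟩ := (hev.and (((eventually_gt_nhds (zero_lt_one' ℝ)).filter_mono
    nhdsWithin_le_nhds).and eventually_mem_nhdsWithin)).exists
  obtain ⟨m, hm⟩ := h a ⟨le_of_lt ha0, le_of_lt ha1⟩ 1 ⟨zero_le_one, le_rfl⟩ ha1 ha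
  refine ⟨m, ?_⟩
  filter_upwards [self_mem_nhdsWithin, nhdsWithin_le_nhds (Ioi_mem_nhds ha1)] with x hx hxa
  have h1 := hm x ⟨le_of_lt hxa, hx.2⟩
  have h2 := hm 1 ⟨le_of_lt ha1, le_rfl⟩
  rw [toReal_map_one g.2.1] at h2
  linarith

/-- A homomorphism recording the logarithms of the slopes at a fixed endpoint. -/
theorem exists_logSlope {e : ℝ} (he : e ∈ Set.Icc (0 : ℝ) 1) (hfix : ∀ g : F, toReal g e = e)
    (hex : ∀ g : F, ∃ m, HasLogSlope e g m) :
    ∃ φ : F → ℤ, (∀ g h, φ (g * h) = φ g + φ h) ∧ ∀ g m, HasLogSlope e g m → φ g = m := by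
  choose φ hφ using hex
  exact ⟨φ, fun g h => (hφ _).unique he ((hφ g).mul (hfix h) (hφ h)), fun g m hm =>
    (hφ g).unique he hm⟩

theorem hasLogSlope_zero_of_eq {g : F} {m : ℤ} {b : ℝ} (hb : 0 < b)
    (h : ∀ x ∈ Set.Icc (0 : ℝ) b, x ≤ 1 → toReal g x = (2 : ℝ) ^ m * x) : HasLogSlope 0 g m := by
  filter_upwards [self_mem_nhdsWithin, nhdsWithin_le_nhds (Iio_mem_nhds hb)] with x hx hxb
  rw [sub_zero, sub_zero]
  exact h x ⟨hx.1, le_of_lt hxb⟩ hx.2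

theorem hasLogSlope_one_of_eq {g : F} {m : ℤ} {a : ℝ} (ha : a < 1)
    (h : ∀ x ∈ Set.Icc a (1 : ℝ), 0 ≤ x → toReal g x - 1 = (2 : ℝ) ^ m * (x - 1)) :
    HasLogSlope 1 g m := by
  filter_upwards [self_mem_nhdsWithin, nhdsWithin_le_nhds (Ioi_mem_nhds ha)] with x hx hxa
  exact h x ⟨le_of_lt hxa, hx.2⟩ hx.1

/-- `x₀` has slope 2 at 0 and slope 1/2 at 1, so the logarithm at 1 is negated to take the value 1
on `b`. Each of `a`, `b` is the identity near the other's endpoint. -/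
theorem weakCopNumber_eq_top {S : Set F} (hfin : S.Finite) (hS : Subgroup.closure S = ⊤) :
    WeakCops.weakCopNumber (SimpleGraph.mulCayley S) = ⊤ := by
  obtain ⟨φ, hφ, hφ'⟩ := exists_logSlope ⟨le_rfl, zero_le_one⟩ (fun g => toReal_zero g.2.1)
    exists_hasLogSlope_zero
  obtain ⟨ψ, hψ, hψ'⟩ := exists_logSlope ⟨zero_le_one, le_rfl⟩ (fun g => toReal_map_one g.2.1)
    exists_hasLogSlope_one
  refine WeakCops.weakCopNumber_mulCayley_eq_top (φ := φ) (ψ := fun g => -ψ g)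
    (a := halves (x₀, 1)) (b := halves (1, x₀)) hfin hS hφ
    (fun g h => by rw [hψ, neg_add]) ?_ (hφ' _ _ ?_) (neg_eq_zero.2 (hψ' _ _ ?_)) (hφ' _ _ ?_)
    (neg_eq_iff_eq_neg.2 (hψ' _ _ ?_))
  · exact Commute.map (Prod.ext (by simp) (by simp) : _ = _) halves
  · refine hasLogSlope_zero_of_eq (b := 1 / 8) (by norm_num) fun x hx hx1 => ?_
    rw [toReal_halves_left _ _ ⟨hx.1, by linarith [hx.2]⟩,
      toReal_x₀ ⟨by linarith [hx.1], by linarith [hx.2]⟩, x₀Fun, if_pos (by linarith [hx.2])]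
    norm_num
  · refine hasLogSlope_one_of_eq (a := 1 / 2) (by norm_num) fun x hx hx0 => ?_
    rw [toReal_halves_right _ _ hx, Subgroup.coe_one,
      toReal_one ⟨by linarith [hx.1], by linarith [hx.2]⟩, zpow_zero]
    ring
  · refine hasLogSlope_zero_of_eq (b := 1 / 2) (by norm_num) fun x hx hx1 => ?_
    rw [toReal_halves_left _ _ hx, Subgroup.coe_one,
      toReal_one ⟨by linarith [hx.1], by linarith [hx.2]⟩, zpow_zero]
    ring
  · refine hasLogSlope_one_of_eq (a := 7 / 8) (by norm_num) fun x hx hx0 => ?_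
    rw [toReal_halves_right _ _ ⟨by linarith [hx.1], hx.2⟩,
      toReal_x₀ ⟨by linarith [hx.1], by linarith [hx.2]⟩, x₀Fun, if_neg (by linarith [hx.1]),
      if_neg (by linarith [hx.1])]
    norm_num
    ring

/-! ### The right-half endomorphism -/

/-- The elements supported on the right half of the interval. -/
noncomputable def rightHalf : F →* F := halves.comp (MonoidHom.inr F F)

theorem rightHalf_apply (g : F) : rightHalf g = halves (1, g) := rfl

/-- On `[1/2, 1]` the map `x₀` is `x ↦ (x + 1) / 2`, the same contraction that defines `rightHalf`;
conjugation by `x₀` thus pushes the support from `[1/2, 1]` into `[3/4, 1]`. -/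
theorem x₀_mul_rightHalf (g : F) : x₀ * rightHalf g = rightHalf (rightHalf g) * x₀ := by
  refine F_ext fun x hx => ?_
  rw [Subgroup.coe_mul, Subgroup.coe_mul, toReal_mul, toReal_mul, toReal_x₀ (toReal_mem _ _),
    toReal_x₀ hx, rightHalf_apply, rightHalf_apply]
  rcases le_or_gt x (1 / 2) with h | h
  · have h1 : x₀Fun x ≤ 3 / 4 := by unfold x₀Fun; split_ifs <;> linarith
    have h2 : 0 ≤ x₀Fun x := by unfold x₀Fun; split_ifs <;> linarith [hx.1]
    rw [toReal_halves_left _ _ ⟨hx.1, h⟩, Subgroup.coe_one, toReal_one ⟨by linarith [hx.1],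
      by linarith⟩, mul_div_cancel_left₀ _ two_ne_zero]
    rcases le_or_gt (x₀Fun x) (1 / 2) with h3 | h3
    · rw [toReal_halves_left _ _ ⟨h2, h3⟩, Subgroup.coe_one, toReal_one ⟨by linarith,
        by linarith⟩, mul_div_cancel_left₀ _ two_ne_zero]
    · rw [toReal_halves_right _ _ ⟨h3.le, by linarith⟩, toReal_halves_left _ _ ⟨by linarith,
        by linarith⟩, Subgroup.coe_one, toReal_one ⟨by linarith, by linarith⟩]
      ring
  · have h1 : x₀Fun x = (x + 1) / 2 := by unfold x₀Fun; split_ifs <;> linarith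
    have h2 : ∀ y, 0 ≤ y → x₀Fun ((y + 1) / 2) = ((y + 1) / 2 + 1) / 2 := fun y hy => by
      unfold x₀Fun; split_ifs <;> linarith
    rw [h1, toReal_halves_right _ _ ⟨h.le, hx.2⟩, h2 _ (toReal_mem _ _).1,
      toReal_halves_right _ _ ⟨by linarith, by linarith [hx.2]⟩,
      toReal_halves_right _ _ ⟨by linarith, by linarith [hx.2]⟩]
    ring_nf

theorem exists_rightHalf_eq {f : F} (hf : ∀ x ∈ Set.Icc (0 : ℝ) (1 / 2), toReal f x = x) :
    ∃ g, rightHalf g = f := by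
  classical
  have hle : ∀ f : F, toReal f (1 / 2) = 1 / 2 → ∀ x ∈ Set.Icc (0 : ℝ) 1,
      1 / 2 ≤ toReal f ((x + 1) / 2) := fun f hf x hx => by
    conv_lhs => rw [← hf]
    exact (toReal_strictMonoOn f.2.1).monotoneOn ⟨by norm_num, by norm_num⟩
      ⟨by linarith [hx.1], by linarith [hx.2]⟩ (by linarith [hx.1])
  have hhalf : (1 / 2 : ℝ) ∈ Set.Icc (0 : ℝ) 1 := ⟨by norm_num, by norm_num⟩
  have h1 : toReal f (1 / 2) = 1 / 2 := hf _ ⟨by norm_num, le_rfl⟩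
  have h2 : toReal ↑f⁻¹ (1 / 2) = 1 / 2 := by
    have := toReal_inv_toReal (f : unitInterval ≃ₜ unitInterval) hhalf
    rwa [h1] at this
  let u : F → ℝ → ℝ := fun f x => 2 * toReal f ((x + 1) / 2) - 1
  have hmaps : ∀ f : F, toReal f (1 / 2) = 1 / 2 →
      Set.MapsTo (u f) (Set.Icc 0 1) (Set.Icc 0 1) := fun f hf x hx =>
    ⟨by linarith [hle f hf x hx], by linarith [(toReal_mem (f : unitInterval ≃ₜ unitInterval)
      ((x + 1) / 2)).2]⟩
  have hpl : IsDyadicPLOn (u f) := by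
    obtain ⟨D, hD, h⟩ := (isDyadicPL_iff _).1 f.2.2
    refine ⟨D.image fun d => 2 * d - 1, fun d hd => ?_, fun a ha b hb hlt hab => ?_⟩
    · obtain ⟨d, hdD, rfl⟩ := Finset.mem_image.1 hd
      convert ((hD d hdD).zpow_mul 1).sub ⟨1, 0, rfl⟩ using 1
      norm_num
    · obtain ⟨m, hm⟩ := h ((a + 1) / 2) ⟨by linarith [ha.1], by linarith [ha.2]⟩ ((b + 1) / 2)
        ⟨by linarith [hb.1], by linarith [hb.2]⟩ (by linarith) fun d hd hdd =>
          hab _ (Finset.mem_image_of_mem _ hd) ⟨by linarith [hdd.1], by linarith [hdd.2]⟩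
      refine ⟨m, fun x hx => ?_⟩
      have := hm ((x + 1) / 2) ⟨by linarith [hx.1], by linarith [hx.2]⟩
      simp only [u]
      linarith
  have hinv : Set.LeftInvOn (u f) (u f⁻¹) (Set.Icc 0 1) := fun x hx => by
    simp only [u]
    rw [sub_add_cancel, mul_div_cancel_left₀ _ two_ne_zero, InvMemClass.coe_inv,
      toReal_toReal_inv _ ⟨by linarith [hx.1], by linarith [hx.2]⟩]
    ring
  have hmono : StrictMonoOn (u f) (Set.Icc 0 1) := fun x hx y hy hxy => by
    have := toReal_strictMonoOn f.2.1 (a := (x + 1) / 2) ⟨by linarith [hx.1], by linarith [hx.2]⟩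
      (b := (y + 1) / 2) ⟨by linarith [hy.1], by linarith [hy.2]⟩ (by linarith)
    simp only [u]
    linarith
  obtain ⟨g, hcoe⟩ : ∃ g : F, ∀ x ∈ Set.Icc (0 : ℝ) 1, toReal g x = u f x :=
    ⟨⟨_, homeoOfReal_mem (hmaps f h1) (hmaps f⁻¹ h2) hinv hmono hpl⟩, fun _ hx =>
      toReal_homeoOfReal (hmaps f h1) (hmaps f⁻¹ h2) hinv hmono hx⟩
  refine ⟨g, F_ext fun x hx => ?_⟩
  rw [rightHalf_apply]
  rcases le_or_gt x (1 / 2) with h | h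
  · rw [toReal_halves_left _ _ ⟨hx.1, h⟩, Subgroup.coe_one, toReal_one ⟨by linarith [hx.1],
      by linarith⟩, hf x ⟨hx.1, h⟩]
    ring
  · rw [toReal_halves_right _ _ ⟨h.le, hx.2⟩,
      hcoe _ ⟨by linarith, by linarith [hx.2]⟩]
    simp only [u]
    ring_nf

/-! ### Dyadic subdivisions -/

/-- Finite binary trees, describing the subdivisions of `[0, 1]` into standard dyadic intervals. -/
inductive DyadicTree
  | leaf : DyadicTree
  | node : DyadicTree → DyadicTree → DyadicTree

/-- A weight that decreases when a tree is rotated to the right. -/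
def DyadicTree.weight : DyadicTree → ℕ
  | .leaf => 1
  | .node s t => 2 * s.weight + t.weight

theorem DyadicTree.weight_pos : ∀ t : DyadicTree, 0 < t.weight
  | .leaf => Nat.one_pos
  | .node _ t => Nat.add_pos_right _ t.weight_pos

/-- The function `u` maps each interval of the subdivision affinely onto a standard dyadic
interval. -/
def IsTreeAffine : DyadicTree → (ℝ → ℝ) → Prop
  | .leaf, u => ∃ i l : ℕ, ∀ x ∈ Set.Icc (0 : ℝ) 1, u x = (i + x) / 2 ^ l
  | .node s t, u => IsTreeAffine s (fun x => u (x / 2)) ∧ IsTreeAffine t (fun x => u ((x + 1) / 2))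

theorem IsTreeAffine.congr {t : DyadicTree} {u v : ℝ → ℝ} (h : IsTreeAffine t u)
    (huv : ∀ x ∈ Set.Icc (0 : ℝ) 1, u x = v x) : IsTreeAffine t v := by
  induction t generalizing u v with
  | leaf =>
    obtain ⟨i, l, h⟩ := h
    exact ⟨i, l, fun x hx => by rw [← huv x hx, h x hx]⟩
  | node s t hs ht =>
    exact ⟨hs h.1 fun x hx => huv _ ⟨by linarith [hx.1], by linarith [hx.2]⟩,
      ht h.2 fun x hx => huv _ ⟨by linarith [hx.1], by linarith [hx.2]⟩⟩

/-- A standard dyadic interval in `(0, 1]` lies in `[1/2, 1]`, `[1/4, 1/2]` or `[0, 1/4]`, on each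
of which `x₀` is affine and preserves standard intervals. Positivity of `u` excludes `[0, 1]` and
`[0, 1/2]`, where `x₀` breaks. -/
theorem IsTreeAffine.x₀Fun_comp {t : DyadicTree} {u : ℝ → ℝ} (h : IsTreeAffine t u)
    (hu : ∀ x ∈ Set.Icc (0 : ℝ) 1, 0 < u x ∧ u x ≤ 1) :
    IsTreeAffine t (fun x => x₀Fun (u x)) := by
  induction t generalizing u with
  | leaf =>
    obtain ⟨i, l, h⟩ := h
    have hi : 0 < i := by
      have h0 := hu 0 ⟨le_rfl, zero_le_one⟩
      rw [h 0 ⟨le_rfl, zero_le_one⟩, add_zero] at h0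
      rcases Nat.eq_zero_or_pos i with rfl | hi
      · simp at h0
      · exact hi
    have hil : i + 1 ≤ 2 ^ l := by
      have h1 := (hu 1 ⟨zero_le_one, le_rfl⟩).2
      rw [h 1 ⟨zero_le_one, le_rfl⟩, div_le_one (by positivity)] at h1
      exact_mod_cast h1
    obtain ⟨l, rfl⟩ : ∃ k, l = k + 1 := ⟨l - 1, by
      rcases l with _ | l
      · simp at hil; omega
      · rfl⟩
    have hpow : (0 : ℝ) < 2 ^ l := by positivity
    rcases le_or_gt (2 ^ l) i with hc | hc
    · refine ⟨i + 2 ^ (l + 1), l + 2, fun x hx => ?_⟩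
      have hc' : (2 : ℝ) ^ l ≤ i := by exact_mod_cast hc
      have h1 : 1 / 2 ≤ u x := by
        rw [h x hx, div_le_div_iff₀ two_pos (by positivity), pow_succ]
        linarith [hx.1]
      have h2 : x₀Fun (u x) = (u x + 1) / 2 := by unfold x₀Fun; split_ifs <;> linarith
      beta_reduce
      rw [h2, h x hx]
      push_cast
      field_simp
      ring
    obtain ⟨l, rfl⟩ : ∃ k, l = k + 1 := ⟨l - 1, by
      rcases l with _ | l
      · simp at hc; omega
      · rfl⟩
    rcases le_or_gt (2 ^ l) i with hd | hd
    · refine ⟨i + 2 ^ l, l + 2, fun x hx => ?_⟩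
      have hd' : (2 : ℝ) ^ l ≤ i := by exact_mod_cast hd
      have hc' : (i : ℝ) + 1 ≤ 2 ^ (l + 1) := by exact_mod_cast hc
      have h1 : 1 / 4 ≤ u x := by
        rw [h x hx, div_le_div_iff₀ four_pos (by positivity), pow_succ, pow_succ]
        linarith [hx.1]
      have h2 : u x ≤ 1 / 2 := by
        rw [h x hx, div_le_div_iff₀ (by positivity) two_pos, pow_succ _ (l + 1)]
        linarith [hx.2]
      have h3 : x₀Fun (u x) = u x + 1 / 4 := by unfold x₀Fun; split_ifs <;> linarith
      beta_reduce
      rw [h3, h x hx]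
      push_cast
      field_simp
      ring
    · refine ⟨i, l + 1, fun x hx => ?_⟩
      have hd' : (i : ℝ) + 1 ≤ 2 ^ l := by exact_mod_cast hd
      have h1 : u x ≤ 1 / 4 := by
        rw [h x hx, div_le_div_iff₀ (by positivity) four_pos, pow_succ, pow_succ]
        linarith [hx.2]
      beta_reduce
      rw [x₀Fun, if_pos h1, h x hx]
      field_simp
      ring
  | node s t hs ht =>
    exact ⟨hs h.1 fun x hx => hu _ ⟨by linarith [hx.1], by linarith [hx.2]⟩,
      ht h.2 fun x hx => hu _ ⟨by linarith [hx.1], by linarith [hx.2]⟩⟩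

theorem IsTreeAffine.two_mul_sub_one {t : DyadicTree} {u : ℝ → ℝ} (h : IsTreeAffine t u)
    (hu : ∀ x ∈ Set.Icc (0 : ℝ) 1, 1 / 2 ≤ u x ∧ u x ≤ 1) :
    IsTreeAffine t (fun x => 2 * u x - 1) := by
  induction t generalizing u with
  | leaf =>
    obtain ⟨i, l, h⟩ := h
    have h0 := (hu 0 ⟨le_rfl, zero_le_one⟩).1
    have h1 := (hu 1 ⟨zero_le_one, le_rfl⟩).2
    rw [h 0 ⟨le_rfl, zero_le_one⟩, add_zero, div_le_div_iff₀ two_pos (by positivity)] at h0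
    rw [h 1 ⟨zero_le_one, le_rfl⟩, div_le_one (by positivity)] at h1
    rcases l with _ | l
    · rw [pow_zero] at h0 h1
      linarith
    · have hi : 2 ^ l ≤ i := by
        rw [pow_succ] at h0
        have : (2 : ℝ) ^ l ≤ i := by linarith
        exact_mod_cast this
      refine ⟨i - 2 ^ l, l, fun x hx => ?_⟩
      beta_reduce
      rw [h x hx, Nat.cast_sub hi, pow_succ]
      push_cast
      field_simp
      ring
  | node s t hs ht =>
    exact ⟨hs h.1 fun x hx => hu _ ⟨by linarith [hx.1], by linarith [hx.2]⟩,
      ht h.2 fun x hx => hu _ ⟨by linarith [hx.1], by linarith [hx.2]⟩⟩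

/-- Halving the domain `p` times cuts the image into `2 ^ p` standard intervals of length `1 / 2 ^
q`. -/
theorem exists_isTreeAffine_of_affine {u : ℝ → ℝ} (i p q : ℕ)
    (hu : ∀ x ∈ Set.Icc (0 : ℝ) 1, u x = (i + 2 ^ p * x) / 2 ^ q) : ∃ t, IsTreeAffine t u := by
  induction p generalizing i u with
  | zero => exact ⟨.leaf, i, q, by simpa using hu⟩
  | succ p ih =>
    obtain ⟨s, hs⟩ := ih (u := fun x => u (x / 2)) i fun x hx => by
      rw [hu _ ⟨by linarith [hx.1], by linarith [hx.2]⟩, pow_succ]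
      ring
    obtain ⟨t, ht⟩ := ih (u := fun x => u ((x + 1) / 2)) (i + 2 ^ p) fun x hx => by
      rw [hu _ ⟨by linarith [hx.1], by linarith [hx.2]⟩, pow_succ]
      push_cast
      ring
    exact ⟨.node s t, hs, ht⟩

theorem exists_isTreeAffine_of_subdivision {u : ℝ → ℝ} (k : ℕ)
    (hu : ∀ j : ℕ, j < 2 ^ k → ∃ t, IsTreeAffine t fun x => u ((j + x) / 2 ^ k)) :
    ∃ t, IsTreeAffine t u := by
  induction k generalizing u with
  | zero => simpa using hu 0 one_pos
  | succ k ih =>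
    obtain ⟨s, hs⟩ := ih (u := fun x => u (x / 2)) fun j hj => by
      obtain ⟨t, ht⟩ := hu j (by rw [pow_succ]; omega)
      refine ⟨t, ht.congr fun x _ => ?_⟩
      rw [pow_succ, div_div]
    obtain ⟨t, ht⟩ := ih (u := fun x => u ((x + 1) / 2)) fun j hj => by
      obtain ⟨t, ht⟩ := hu (j + 2 ^ k) (by rw [pow_succ]; omega)
      refine ⟨t, ht.congr fun x _ => ?_⟩
      congr 1
      push_cast
      field_simp
      ring
    exact ⟨.node s t, hs, ht⟩

theorem exists_common_denominator {D : Finset ℝ} (hD : ∀ d ∈ D, IsDyadic d) :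
    ∃ k : ℕ, ∀ d ∈ D, ∃ a : ℤ, d = a / 2 ^ k := by
  classical
  induction D using Finset.induction_on with
  | empty => simp
  | insert d D _ ih =>
    obtain ⟨k, hk⟩ := ih fun e he => hD e (Finset.mem_insert_of_mem he)
    obtain ⟨b, l, hb⟩ := hD d (Finset.mem_insert_self _ _)
    refine ⟨k + l, fun e he => ?_⟩
    rcases Finset.mem_insert.1 he with rfl | he
    · refine ⟨b * 2 ^ k, ?_⟩
      rw [hb, pow_add]
      push_cast
      field_simp
    · obtain ⟨a, ha⟩ := hk e he
      refine ⟨a * 2 ^ l, ?_⟩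
      rw [ha, pow_add]
      push_cast
      field_simp

theorem exists_isTreeAffine (f : F) : ∃ t, IsTreeAffine t (toReal f) := by
  obtain ⟨D, hD, h⟩ := (isDyadicPL_iff _).1 f.2.2
  obtain ⟨k, hk⟩ := exists_common_denominator hD
  refine exists_isTreeAffine_of_subdivision k fun j hj => ?_
  have hpow : (0 : ℝ) < 2 ^ k := by positivity
  have hj' : (j : ℝ) + 1 ≤ 2 ^ k := by exact_mod_cast hj
  have hmem : ∀ x ∈ Set.Icc (0 : ℝ) 1, (j + x) / 2 ^ k ∈ Set.Icc (0 : ℝ) 1 := fun x hx =>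
    ⟨div_nonneg (add_nonneg j.cast_nonneg hx.1) hpow.le,
      (div_le_one hpow).2 (by linarith [hx.2])⟩
  have h0 := hmem 0 ⟨le_rfl, zero_le_one⟩
  obtain ⟨m, hm⟩ := h ((j + 0) / 2 ^ k) h0 ((j + 1) / 2 ^ k)
    (hmem 1 ⟨zero_le_one, le_rfl⟩) (by gcongr; exact zero_lt_one) fun d hd hdd => by
      obtain ⟨a, rfl⟩ := hk d hd
      have h1 : (j : ℤ) < a := by
        have := (div_lt_div_iff_of_pos_right hpow).1 hdd.1
        rw [add_zero] at this
        exact_mod_cast this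
      have h2 : a < (j : ℤ) + 1 := by exact_mod_cast (div_lt_div_iff_of_pos_right hpow).1 hdd.2
      omega
  obtain ⟨b, l, hb⟩ : IsDyadic (toReal f ((j + 0) / 2 ^ k)) := by
    have := (isDyadic_apply_iff _ f.2.1 f.2.2 ⟨_, h0⟩).2 ⟨j, k, by push_cast; rw [add_zero]⟩
    rwa [← toReal_coe] at this
  have hb0 : 0 ≤ b := by
    have := (toReal_mem (f : unitInterval ≃ₜ unitInterval) ((j + 0) / 2 ^ k)).1
    rw [hb, le_div_iff₀ (by positivity), zero_mul] at this
    exact_mod_cast this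
  lift b to ℕ using hb0
  -- The slope exponent `m` may be negative; adding `m.natAbs` to numerator and denominator makes
  -- all exponents natural.
  obtain ⟨p, hp⟩ : ∃ p : ℕ, (p : ℤ) = m + l + m.natAbs := ⟨(m + l + m.natAbs).toNat, by omega⟩
  refine exists_isTreeAffine_of_affine (b * 2 ^ (m.natAbs + k)) p (l + m.natAbs + k) fun x hx => ?_
  have h1 := hm ((j + x) / 2 ^ k) ⟨by gcongr; exact hx.1, by gcongr; exact hx.2⟩
  have h2 : (2 : ℝ) ^ p = 2 ^ m * 2 ^ l * 2 ^ m.natAbs := by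
    rw [← zpow_natCast, hp, zpow_add₀ two_ne_zero, zpow_add₀ two_ne_zero, zpow_natCast,
      zpow_natCast]
  rw [sub_eq_iff_eq_add.1 h1, hb, h2]
  push_cast
  rw [pow_add, pow_add, pow_add]
  field_simp
  ring

/-! ### Generation by two elements -/

theorem toReal_x₀_inv {x : ℝ} (hx : x ∈ Set.Icc (0 : ℝ) 1) : toReal ↑x₀⁻¹ x = x₀InvFun x := by
  have h : x₀InvFun x ∈ Set.Icc (0 : ℝ) 1 := by
    obtain ⟨h0, h1⟩ := hx
    unfold x₀InvFun
    constructor <;> split_ifs <;> linarith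
  have h1 := toReal_inv_toReal (x₀ : unitInterval ≃ₜ unitInterval) h
  rwa [toReal_x₀ h, x₀Fun_x₀InvFun] at h1

/-- While the left half is mapped into `[0, 1/4]`, left multiplication by `x₀` doubles its image. At
`l = 0` the left half is fixed, and `f` is `rightHalf g` with `g` affine on `t`. -/
theorem mem_of_isTreeAffine_node_leaf {H : Subgroup F} (hx₀ : x₀ ∈ H)
    (hH : ∀ g ∈ H, rightHalf g ∈ H) {t : DyadicTree}
    (ht : ∀ f : F, IsTreeAffine t (toReal f) → f ∈ H) (l : ℕ) (f : F)
    (hl : ∀ x ∈ Set.Icc (0 : ℝ) 1, toReal f (x / 2) = x / 2 ^ (l + 1))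
    (hf : IsTreeAffine t (fun x => toReal f ((x + 1) / 2))) : f ∈ H := by
  induction l generalizing f with
  | zero =>
    obtain ⟨g, rfl⟩ := exists_rightHalf_eq (f := f) fun x hx => by
      have := hl (2 * x) ⟨by linarith [hx.1], by linarith [hx.2]⟩
      rwa [zero_add, pow_one, mul_div_cancel_left₀ _ two_ne_zero] at this
    refine hH g (ht g ?_)
    have h : ∀ x ∈ Set.Icc (0 : ℝ) 1,
        toReal ↑(rightHalf g) ((x + 1) / 2) = (toReal g x + 1) / 2 := fun x hx => by
      rw [rightHalf_apply, toReal_halves_right _ _ ⟨by linarith [hx.1], by linarith [hx.2]⟩,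
        mul_div_cancel₀ _ two_ne_zero, add_sub_cancel_right]
    refine (hf.two_mul_sub_one fun x hx => ?_).congr fun x hx => ?_
    · have := toReal_mem (g : unitInterval ≃ₜ unitInterval) x
      rw [h x hx]
      exact ⟨by linarith [this.1], by linarith [this.2]⟩
    · rw [h x hx]
      ring
  | succ l ih =>
    refine (H.mul_mem_cancel_left hx₀).1 (ih (x₀ * f) (fun x hx => ?_) ?_)
    · have hx' : x / 2 ^ (l + 1 + 1) ≤ 1 / 4 := by
        have : (1 : ℝ) ≤ 2 ^ l := one_le_pow₀ one_le_two
        rw [div_le_div_iff₀ (by positivity) four_pos, pow_succ, pow_succ]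
        linarith [hx.2]
      rw [Subgroup.coe_mul, toReal_mul, toReal_x₀ (toReal_mem _ _), hl x hx, x₀Fun, if_pos hx',
        pow_succ _ (l + 1)]
      field_simp
    · refine (hf.x₀Fun_comp fun x hx => ⟨?_, (toReal_mem _ _).2⟩).congr fun x hx => ?_
      · have := toReal_strictMonoOn f.2.1 (a := 0) ⟨le_rfl, zero_le_one⟩ (b := (x + 1) / 2)
          ⟨by linarith [hx.1], by linarith [hx.2]⟩ (by linarith [hx.1])
        rwa [toReal_zero f.2.1] at this
      · rw [Subgroup.coe_mul, toReal_mul, toReal_x₀ (toReal_mem _ _)]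

theorem mem_of_isTreeAffine {H : Subgroup F} (hx₀ : x₀ ∈ H) (hH : ∀ g ∈ H, rightHalf g ∈ H) :
    ∀ (t : DyadicTree) (f : F), IsTreeAffine t (toReal f) → f ∈ H
  | .leaf, f, ⟨i, l, h⟩ => by
    have h0 := h 0 ⟨le_rfl, zero_le_one⟩
    have h1 := h 1 ⟨zero_le_one, le_rfl⟩
    rw [toReal_zero f.2.1, eq_comm, div_eq_zero_iff, or_iff_left (by positivity), add_zero] at h0
    rw [toReal_map_one f.2.1, h0, zero_add] at h1
    have hf : f = 1 := F_ext fun x hx => by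
      rw [h x hx, h0, zero_add, div_eq_mul_one_div, ← h1, mul_one, Subgroup.coe_one, toReal_one hx]
    exact hf ▸ H.one_mem
  | .node .leaf t, f, ⟨⟨i, l, h⟩, hf⟩ => by
    have h0 := h 0 ⟨le_rfl, zero_le_one⟩
    simp only [zero_div, toReal_zero f.2.1] at h0
    rw [eq_comm, div_eq_zero_iff, or_iff_left (by positivity), add_zero] at h0
    simp only [h0, zero_add] at h
    -- For `l = 0` the left half would already cover `[0, 1]`, forcing `f (1/2) = 1`.
    rcases l with _ | l
    · have h1 := h 1 ⟨zero_le_one, le_rfl⟩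
      have h2 := toReal_strictMonoOn f.2.1 (a := 1 / 2) ⟨by norm_num, by norm_num⟩ (b := 1)
        ⟨zero_le_one, le_rfl⟩ (by norm_num)
      rw [h1, toReal_map_one f.2.1] at h2
      norm_num at h2
    · exact mem_of_isTreeAffine_node_leaf hx₀ hH (mem_of_isTreeAffine hx₀ hH t) l f h hf
  | .node (.node r s) t, f, ⟨⟨hr, hs⟩, ht⟩ => by
    -- Tree rotation: `x₀⁻¹` carries `[0, 1/2]`, `[1/2, 3/4]`, `[3/4, 1]` affinely to `[0, 1/4]`,
    -- `[1/4, 1/2]`, `[1/2, 1]`, the domains of `r`, `s`, `t`.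
    refine (H.mul_mem_cancel_right (H.inv_mem hx₀)).1
      (mem_of_isTreeAffine hx₀ hH (.node r (.node s t)) (f * x₀⁻¹)
        ⟨hr.congr fun x hx => ?_, hs.congr fun x hx => ?_, ht.congr fun x hx => ?_⟩)
    all_goals
      obtain ⟨hx0, hx1⟩ := hx
      beta_reduce
      rw [Subgroup.coe_mul, toReal_mul, toReal_x₀_inv ⟨by linarith, by linarith⟩]
      congr 1
      unfold x₀InvFun
      split_ifs <;> linarith
termination_by t => t.weight
decreasing_by
  · simp only [DyadicTree.weight]
    omega
  · have := r.weight_pos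
    simp only [DyadicTree.weight]
    omega

theorem closure_eq_top : Subgroup.closure {x₀, rightHalf x₀} = ⊤ := by
  have h0 : x₀ ∈ Subgroup.closure {x₀, rightHalf x₀} := Subgroup.subset_closure (by simp)
  have h1 : rightHalf x₀ ∈ Subgroup.closure {x₀, rightHalf x₀} :=
    Subgroup.subset_closure (by simp)
  rw [eq_top_iff]
  intro f _
  obtain ⟨t, ht⟩ := exists_isTreeAffine f
  refine mem_of_isTreeAffine h0 ?_ t f ht
  intro g hg
  -- Stability under `rightHalf` need only be checked on generators; `rightHalf (rightHalf x₀)` is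
  -- the conjugate of `rightHalf x₀` by `x₀`.
  have hle : Subgroup.closure {x₀, rightHalf x₀} ≤
      (Subgroup.closure {x₀, rightHalf x₀}).comap rightHalf := by
    rw [Subgroup.closure_le]
    rintro _ (rfl | rfl)
    · exact h1
    · rw [SetLike.mem_coe, Subgroup.mem_comap, ← mul_inv_eq_of_eq_mul (x₀_mul_rightHalf x₀)]
      exact mul_mem (mul_mem h0 h1) (inv_mem h0)
  exact hle hg

instance : Group.FG F :=
  Group.fg_iff.2 ⟨{x₀, rightHalf x₀}, closure_eq_top, Set.toFinite _⟩

end Thompson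

theorem theorem1p5 :
    Group.FG Thompson.F ∧
      ∀ S : Set Thompson.F, S.Finite → Subgroup.closure S = ⊤ →
        WeakCops.weakCopNumber (SimpleGraph.mulCayley S) = ⊤ :=
  ⟨inferInstance, fun _ hfin hS => Thompson.weakCopNumber_eq_top hfin hS⟩
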